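/- A \emph{continuum} is a nonempty compact connected metric space. For a continuum $X$ let $2^X$ be the space of nonempty closed subsets of $X$ with the Hausdorff metric, and let $C(X)\subset 2^X$ be the subspace of subcontinua (nonempty compact connected subsets) of $X$. A subcontinuum $K$ of $X$ is \emph{terminal} if every subcontinuum $L$ of $X$ with $K\cap L\neq\emptyset$ satisfies $K\subset L$ or $L\subset K$; it is \emph{filament} if there is an open set $U\supset K$ such that the component of $U$ containing $K$ has empty interior; it is \emph{ample} if for every open $U\supset K$ there is $L\in C(X)$ with $K\subset\operatorname{int}(L)\subset L\subset U$. Let $\mathcal F$ and $\mathcal A$ be the sets of filament and of ample subcontinua of $X$. The \emph{Planck boundary} of $C(X)$ is $\mathcal P=\mathcal A\cap\overline{\mathcal F}$, the closure being taken in $C(X)$. A \emph{pseudo-arc} is a nondegenerate hereditarily indecomposable chainable continuum. A \emph{Whitney map} is a continuous $\mu:2^X\to[0,\infty)$ such that $\mu(\{x\})=0$ for all $x\in X$; $\mu(A)<\mu(B)$ whenever $A\subsetneq B$; and $\mu(A\cup B)\le\mu(A)+\mu(B)-\mu(A\cap B)$ whenever $A\cap B\ne\emptyset$. Write $\mu_C=\mu|_{C(X)}$.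 \textbf{Corollary.} Let $\Psi_0$ be a circle of pseudo-arcs, that is, a continuum with a continuous open surjection $\Pi:\Psi_0\to S^1$ all of whose fibers $P_\alpha=\Pi^{-1}(e^{i\alpha})$, $\alpha\in[0,2\pi)$, are pseudo-arcs and terminal subcontinua of $\Psi_0$. Let $\mu:2^{\Psi_0}\to[0,\infty)$ be a Whitney map and suppose that there is a constant $l$ (the Planck constant of $\Psi_0$) with $\mu_C(P_\alpha)=l$ for all $\alpha\in[0,2\pi)$. Then the Planck boundary of $C(\Psi_0)$ is the Whitney level set defined by $l$: $$\mathcal P=\mu_C^{-1}(l).$$ -/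

import Mathlib

open TopologicalSpace

/-- The hyperspace `C(X)` of subcontinua of `X` (nonempty compact connected subsets).
`NonemptyCompacts X` is the hyperspace `2^X` with the Hausdorff metric, and `C(X)` carries the
induced metric. -/
abbrev Hyperspace (X : Type*) [MetricSpace X] : Type _ :=
  {K : NonemptyCompacts X // IsConnected (K : Set X)}

namespace Hyperspace

variable {X : Type*} [MetricSpace X]

/-- The underlying subset of a subcontinuum. -/
def carrier (K : Hyperspace X) : Set X := (K.1 : Set X)

/-- `K` is decomposable: it is the union of two proper subcontinua. -/
def Decomposable (K : Hyperspace X) : Prop :=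
  ∃ A B : Hyperspace X,
    A.carrier ≠ K.carrier ∧ B.carrier ≠ K.carrier ∧ A.carrier ∪ B.carrier = K.carrier

/-- `K` is terminal in `X`: every subcontinuum meeting `K` contains `K` or is contained in `K`. -/
def Terminal (K : Hyperspace X) : Prop :=
  ∀ L : Hyperspace X, (K.carrier ∩ L.carrier).Nonempty →
    K.carrier ⊆ L.carrier ∨ L.carrier ⊆ K.carrier

/-- `K` is filament: some open `U ⊇ K` is such that the component of `U` containing `K` has empty
interior. -/
def Filament (K : Hyperspace X) : Prop :=
  ∃ U : Set X, IsOpen U ∧ K.carrier ⊆ U ∧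
    ∀ x ∈ K.carrier, interior (connectedComponentIn U x) = ∅

/-- `K` is ample: each open `U ⊇ K` contains a subcontinuum whose interior contains `K`. -/
def Ample (K : Hyperspace X) : Prop :=
  ∀ U : Set X, IsOpen U → K.carrier ⊆ U →
    ∃ L : Hyperspace X, K.carrier ⊆ interior L.carrier ∧ L.carrier ⊆ U

end Hyperspace

/-- The filament portion of `C(X)`. -/
def filamentPortion (X : Type*) [MetricSpace X] : Set (Hyperspace X) := {K | K.Filament}

/-- The ample portion of `C(X)`. -/
def amplePortion (X : Type*) [MetricSpace X] : Set (Hyperspace X) := {K | K.Ample}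

/-- The Planck boundary: the ample elements in the closure of the filament portion, the closure
being taken in `C(X)`. -/
def planckBoundary (X : Type*) [MetricSpace X] : Set (Hyperspace X) :=
  amplePortion X ∩ closure (filamentPortion X)

/-- `X` is chainable: for each `ε > 0` it has a finite open cover `C₁, …, Cₙ` by sets of diameter
less than `ε` with `C_k ∩ C_l ≠ ∅` if and only if `|k - l| ≤ 1`. -/
def Chainable (X : Type*) [MetricSpace X] : Prop :=
  ∀ ε : ℝ, 0 < ε → ∃ (n : ℕ) (C : Fin n → Set X),
    (∀ k, IsOpen (C k)) ∧ (⋃ k, C k) = Set.univ ∧ (∀ k, Metric.diam (C k) < ε) ∧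
      ∀ k l : Fin n, (C k ∩ C l).Nonempty ↔ |((k : ℕ) : ℤ) - ((l : ℕ) : ℤ)| ≤ 1

/-- `X` is a pseudo-arc: a nondegenerate, chainable, hereditarily indecomposable continuum. -/
structure IsPseudoArc (X : Type*) [MetricSpace X] : Prop where
  compact : CompactSpace X
  connected : ConnectedSpace X
  nondegenerate : Nontrivial X
  chainable : Chainable X
  hereditarilyIndecomposable : ∀ K : Hyperspace X, ¬ K.Decomposable

/-- `p : X → S¹` exhibits the continuum `X` as a circle of pseudo-arcs: it is an open map (that is,
its fibers form a continuous decomposition of `X`), all of whose fibers are pseudo-arcs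
and terminal subcontinua of `X`. (Surjectivity holds because the fibers are nonempty.) -/
structure IsCircleOfPseudoArcs {X : Type*} [MetricSpace X] (p : X → Circle) : Prop where
  continuous : Continuous p
  isOpenMap : IsOpenMap p
  pseudoArc : ∀ z : Circle, IsPseudoArc (p ⁻¹' {z})
  terminal : ∀ (z : Circle) (K : Hyperspace X), K.carrier = p ⁻¹' {z} → K.Terminal

/-- The pseudo-arc `p⁻¹(z)` of the decomposition, as an element of `C(X)`. -/
def IsCircleOfPseudoArcs.fiber {X : Type*} [MetricSpace X] {p : X → Circle}
    (hp : IsCircleOfPseudoArcs p) (z : Circle) : Hyperspace X :=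
  ⟨⟨⟨p ⁻¹' {z}, isCompact_iff_compactSpace.mpr (hp.pseudoArc z).compact⟩,
      (isConnected_iff_connectedSpace.mpr (hp.pseudoArc z).connected).nonempty⟩,
    isConnected_iff_connectedSpace.mpr (hp.pseudoArc z).connected⟩

/-- Whitney maps on `2^X`, with the submodularity condition. -/
structure IsWhitneyMap {X : Type*} [MetricSpace X] (μ : NonemptyCompacts X → ℝ) : Prop where
  continuous : Continuous μ
  nonneg : ∀ A, 0 ≤ μ A
  singleton : ∀ (x : X) (A : NonemptyCompacts X), (A : Set X) = {x} → μ A = 0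
  strictMono : ∀ A B : NonemptyCompacts X, (A : Set X) ⊂ (B : Set X) → μ A < μ B
  submodular : ∀ A B I : NonemptyCompacts X, (I : Set X) = (A : Set X) ∩ (B : Set X) →
    μ (A ⊔ B) ≤ μ A + μ B - μ I

/-- The restriction `μ_C` of `μ` from `2^X` to `C(X)`. -/
def whitneyRestrict {X : Type*} [MetricSpace X] (μ : NonemptyCompacts X → ℝ) :
    Hyperspace X → ℝ :=
  fun K => μ K.1

open Set Topology

/-! By terminality every subcontinuum is comparable with each fiber it meets, so strict monotonicity
of `μ` makes the level set of `l` exactly the set of fibers. It remains to see that the Planck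
boundary is also the set of fibers. A proper subcontinuum of a fiber is filament, hence not ample. A
subcontinuum in no single fiber is saturated over a nondegenerate connected subset of the circle, so
it has interior and is not filament. Filament subcontinua therefore satisfy `μ ≤ l`, a closed
condition, which excludes anything strictly larger than a fiber from the closure. Conversely, fibers
are ample because preimages of small closed arcs are continua (`ample_fiber`). They are limits of
filament subcontinua because an indecomposable continuum has ε-dense proper subcontinua
(`exists_ne_univ_forall_dist_le`). -/

/-- A nondegenerate connected subset of the circle has nonempty interior. -/
lemma Circle.interior_nonempty_of_isPreconnected {S : Set Circle} (hS : IsPreconnected S)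
    (hnt : S.Nontrivial) : (interior S).Nonempty := by
  by_cases huniv : S = univ
  · simp [huniv]
  obtain ⟨w, hw⟩ := (ne_univ_iff_exists_notMem S).1 huniv
  -- This rotation sends `w` to `-1`, on the branch cut of `arg`, so `arg ∘ r` is continuous at
  -- every point of `S`.
  let r : Circle → ℂ := fun z => ((-w⁻¹ * z : Circle) : ℂ)
  have hr : Continuous r := by fun_prop
  have hslit : ∀ z, z ≠ w → r z ∈ Complex.slitPlane := by
    intro z hz
    rw [Complex.mem_slitPlane_iff_arg]
    refine ⟨fun h => hz ?_, Circle.coe_ne_zero _⟩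
    have h1 : (-w⁻¹ * z : Circle) = -1 := by
      apply Circle.injective_arg
      simpa [r] using h
    have h2 : w⁻¹ * z = 1 := by
      have := congrArg (fun u : Circle => -u) h1
      simpa using this
    exact (inv_mul_eq_one.1 h2).symm
  let a : Circle → ℝ := fun z => Complex.arg (r z)
  have ha : ∀ z, z ≠ w → ContinuousAt a z := fun z hz =>
    ContinuousAt.comp (f := r) (Complex.continuousAt_arg (hslit z hz)) hr.continuousAt
  have hinj : Function.Injective a := fun x y h => mul_left_cancel (Circle.injective_arg h)
  have hSw : ∀ z ∈ S, z ≠ w := fun z hz h => hw (h ▸ hz)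
  have himg : IsPreconnected (a '' S) :=
    hS.image a fun z hz => (ha z (hSw z hz)).continuousWithinAt
  have key : ∀ x ∈ S, ∀ y ∈ S, a x < a y → (interior S).Nonempty := by
    intro x hx y hy hxy
    have hIcc := himg.Icc_subset (mem_image_of_mem a hx) (mem_image_of_mem a hy)
    obtain ⟨m, hm⟩ := exists_between hxy
    obtain ⟨z, hz, rfl⟩ := hIcc ⟨hm.1.le, hm.2.le⟩
    refine ⟨z, mem_interior_iff_mem_nhds.2 ?_⟩
    filter_upwards [(ha z (hSw z hz)).preimage_mem_nhds (Ioo_mem_nhds hm.1 hm.2)] with u hu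
    obtain ⟨v, hv, hvu⟩ := hIcc ⟨hu.1.le, hu.2.le⟩
    exact hinj hvu ▸ hv
  obtain ⟨x, hx, y, hy, hxy⟩ := hnt
  rcases lt_or_gt_of_ne (hinj.ne hxy) with h | h
  exacts [key x hx y hy h, key y hy x hx h]

/-- Boundary bumping: in a compact connected space, the component of a point in the complement of
a nonempty open set `V` reaches the closure of `V`. -/
lemma exists_isConnected_subset_compl_inter_closure_nonempty {P : Type*} [TopologicalSpace P]
    [T2Space P] [CompactSpace P] [ConnectedSpace P] {V : Set P} (hV : IsOpen V)
    (hVne : V.Nonempty) {x : P} (hx : x ∉ V) :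
    ∃ C : Set P, IsClosed C ∧ IsConnected C ∧ x ∈ C ∧ C ⊆ Vᶜ ∧ (C ∩ closure V).Nonempty := by
  have hF : IsClosed (Vᶜ) := hV.isClosed_compl
  have : CompactSpace (Vᶜ : Set P) := isCompact_iff_compactSpace.1 hF.isCompact
  let x' : (Vᶜ : Set P) := ⟨x, hx⟩
  refine ⟨Subtype.val '' connectedComponent x',
    hF.isClosedEmbedding_subtypeVal.isClosedMap _ isClosed_connectedComponent,
    isConnected_connectedComponent.image _ continuous_subtype_val.continuousOn,
    ⟨x', mem_connectedComponent, rfl⟩, ?_, ?_⟩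
  · rintro _ ⟨y, -, rfl⟩
    exact y.2
  by_contra hdisj
  rw [not_nonempty_iff_eq_empty] at hdisj
  have hO : IsOpen {y : (Vᶜ : Set P) | (y : P) ∉ closure V} :=
    isClosed_closure.isOpen_compl.preimage continuous_subtype_val
  -- In a compact Hausdorff space components are quasi-components; compactness then yields one
  -- clopen `Q` missing `closure V`, and `Q` is clopen in all of `P`.
  have hsub : (⋂ s : { s : Set (Vᶜ : Set P) // IsClopen s ∧ x' ∈ s }, (s : Set (Vᶜ : Set P))) ⊆
      {y | (y : P) ∉ closure V} := by
    rw [← connectedComponent_eq_iInter_isClopen]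
    intro y hy hyV
    exact (hdisj ▸ (⟨⟨y, hy, rfl⟩, hyV⟩ :
      (y : P) ∈ Subtype.val '' connectedComponent x' ∩ closure V) : (y : P) ∈ (∅ : Set P))
  have hne : Nonempty { s : Set (Vᶜ : Set P) // IsClopen s ∧ x' ∈ s } :=
    ⟨⟨univ, isClopen_univ, mem_univ _⟩⟩
  obtain ⟨⟨Q, hQ, hxQ⟩, hQV⟩ := exists_subset_nhds_of_compactSpace
    (V := fun s : { s : Set (Vᶜ : Set P) // IsClopen s ∧ x' ∈ s } => (s : Set (Vᶜ : Set P)))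
    (fun s t => ⟨⟨s.1 ∩ t.1, s.2.1.inter t.2.1, s.2.2, t.2.2⟩,
      inter_subset_left, inter_subset_right⟩)
    (fun s => s.2.1.isClosed) (fun y hy => hO.mem_nhds (hsub hy))
  have hcl : IsClosed (Subtype.val '' Q : Set P) :=
    hF.isClosedEmbedding_subtypeVal.isClosedMap _ hQ.isClosed
  have hop : IsOpen (Subtype.val '' Q : Set P) := by
    obtain ⟨W, hW, rfl⟩ := isOpen_induced_iff.1 hQ.isOpen
    have : (Subtype.val '' (Subtype.val ⁻¹' W : Set (Vᶜ : Set P))) = W ∩ (closure V)ᶜ := by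
      ext y
      constructor
      · rintro ⟨z, hz, rfl⟩
        exact ⟨hz, hQV hz⟩
      · rintro ⟨hy, hyV⟩
        exact ⟨⟨y, fun h => hyV (subset_closure h)⟩, hy, rfl⟩
    rw [this]
    exact hW.inter isClosed_closure.isOpen_compl
  have huniv := IsClopen.eq_univ ⟨hcl, hop⟩ ⟨x, x', hxQ, rfl⟩
  obtain ⟨v, hv⟩ := hVne
  obtain ⟨y, -, rfl⟩ := (huniv ▸ mem_univ v : v ∈ Subtype.val '' Q)
  exact y.2 hv

/-! ### Subcontinua and indecomposability -/

namespace Hyperspace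

variable {X : Type*} [MetricSpace X]

/-- The subcontinuum with a given compact connected underlying set. -/
def ofSet (S : Set X) (hS : IsCompact S) (hc : IsConnected S) : Hyperspace X :=
  ⟨⟨⟨S, hS⟩, hc.nonempty⟩, hc⟩

@[simp] lemma carrier_ofSet (S : Set X) (hS : IsCompact S) (hc : IsConnected S) :
    (ofSet S hS hc).carrier = S := rfl

lemma isCompact_carrier (K : Hyperspace X) : IsCompact K.carrier := K.1.isCompact

lemma isConnected_carrier (K : Hyperspace X) : IsConnected K.carrier := K.2

lemma carrier_injective : Function.Injective (carrier : Hyperspace X → Set X) :=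
  fun _ _ h => Subtype.ext (NonemptyCompacts.ext h)

/-- Filament subcontinua are not ample. -/
lemma Filament.not_ample {K : Hyperspace X} (hK : K.Filament) : ¬ K.Ample := by
  intro hA
  obtain ⟨U, hU, hKU, hint⟩ := hK
  obtain ⟨L, hKL, hLU⟩ := hA U hU hKU
  obtain ⟨x, hx⟩ := K.isConnected_carrier.nonempty
  have hsub : L.carrier ⊆ connectedComponentIn U x :=
    L.isConnected_carrier.isPreconnected.subset_connectedComponentIn
      (interior_subset (hKL hx)) hLU
  have := interior_mono hsub (hKL hx)
  rw [hint x hx] at this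
  exact this

/-- The whole continuum is a limit of proper subcontinua if it is indecomposable. -/
lemma exists_ne_univ_forall_dist_le {P : Type*} [MetricSpace P] [CompactSpace P]
    [ConnectedSpace P] [Nontrivial P] (hP : ∀ K : Hyperspace P, ¬ K.Decomposable)
    {ε : ℝ} (hε : 0 < ε) :
    ∃ K : Hyperspace P, K.carrier ≠ univ ∧ ∀ c : P, ∃ y ∈ K.carrier, dist c y ≤ ε := by
  obtain ⟨x⟩ := (inferInstance : Nonempty P)
  have hone : ∀ c : P, ∃ K : Hyperspace P, K.carrier ≠ univ ∧ x ∈ K.carrier ∧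
      ∃ y ∈ K.carrier, dist c y ≤ ε / 2 := by
    intro c
    by_cases hx : x ∈ Metric.ball c (ε / 2)
    · refine ⟨ofSet {x} isCompact_singleton isConnected_singleton, ?_, rfl, x, rfl, ?_⟩
      · exact nonempty_compl.1 (exists_ne x)
      · rw [dist_comm]
        exact (Metric.mem_ball.1 hx).le
    · have hc : c ∈ Metric.ball c (ε / 2) := Metric.mem_ball_self (by positivity)
      obtain ⟨C, hCc, hCconn, hxC, hCV, y, hyC, hyV⟩ :=
        exists_isConnected_subset_compl_inter_closure_nonempty Metric.isOpen_ball ⟨c, hc⟩ hx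
      refine ⟨ofSet C hCc.isCompact hCconn, ?_, hxC, y, hyC, ?_⟩
      · intro h
        rw [carrier_ofSet] at h
        exact hCV (h.symm ▸ mem_univ c) hc
      · rw [dist_comm]
        exact Metric.mem_closedBall.1 (Metric.closure_ball_subset_closedBall hyV)
  have hfin : ∀ t : Finset P, ∃ K : Hyperspace P, K.carrier ≠ univ ∧ x ∈ K.carrier ∧
      ∀ c ∈ t, ∃ y ∈ K.carrier, dist c y ≤ ε / 2 := by
    intro t
    classical
    induction t using Finset.induction_on with
    | empty =>
      obtain ⟨K, h1, h2, -⟩ := hone x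
      exact ⟨K, h1, h2, by simp⟩
    | insert c t _ ih =>
      obtain ⟨K, hK, hxK, hKt⟩ := ih
      obtain ⟨L, hL, hxL, y, hy, hyd⟩ := hone c
      -- All the pieces contain `x`, so the union is connected; indecomposability keeps it proper.
      refine ⟨ofSet (K.carrier ∪ L.carrier) (K.isCompact_carrier.union L.isCompact_carrier)
        (K.isConnected_carrier.union ⟨x, hxK, hxL⟩ L.isConnected_carrier), ?_, Or.inl hxK, ?_⟩
      · intro h
        exact hP (ofSet univ isCompact_univ isConnected_univ) ⟨K, L, hK, hL, h⟩
      · intro d hd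
        rcases Finset.mem_insert.1 hd with rfl | hd
        · exact ⟨y, Or.inr hy, hyd⟩
        · obtain ⟨z, hz, hzd⟩ := hKt d hd
          exact ⟨z, Or.inl hz, hzd⟩
  obtain ⟨t, ht, hcov⟩ :=
    Metric.totallyBounded_iff.1 (isCompact_univ (X := P)).totallyBounded (ε / 2) (half_pos hε)
  obtain ⟨K, hK, -, hKt⟩ := hfin ht.toFinset
  refine ⟨K, hK, fun c => ?_⟩
  obtain ⟨d, hd, hcd⟩ := mem_iUnion₂.1 (hcov (mem_univ c))
  obtain ⟨y, hy, hyd⟩ := hKt d (ht.mem_toFinset.2 hd)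
  refine ⟨y, hy, (dist_triangle c d y).trans ?_⟩
  have := Metric.mem_ball.1 hcd
  linarith

end Hyperspace

/-! ### Filament and ample subcontinua of a circle of pseudo-arcs -/

namespace IsCircleOfPseudoArcs

open Hyperspace

variable {X : Type*} [MetricSpace X] {p : X → Circle}

lemma carrier_fiber (hp : IsCircleOfPseudoArcs p) (z : Circle) :
    (hp.fiber z).carrier = p ⁻¹' {z} := rfl

lemma surjective (hp : IsCircleOfPseudoArcs p) : Function.Surjective p := fun z =>
  (hp.fiber z).isConnected_carrier.nonempty

/-- A subcontinuum lies in a fiber or is saturated with nondegenerate image. -/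
lemma subset_fiber_or_saturated (hp : IsCircleOfPseudoArcs p) (K : Hyperspace X) :
    (∃ z, K.carrier ⊆ p ⁻¹' {z}) ∨
      ((p '' K.carrier).Nontrivial ∧ p ⁻¹' (p '' K.carrier) ⊆ K.carrier) := by
  by_cases h : ∃ z, K.carrier ⊆ p ⁻¹' {z}
  · exact Or.inl h
  refine Or.inr ⟨?_, ?_⟩
  · rw [← not_subsingleton_iff]
    intro hs
    obtain ⟨x, hx⟩ := K.isConnected_carrier.nonempty
    exact h ⟨p x, fun y hy => hs (mem_image_of_mem p hy) (mem_image_of_mem p hx)⟩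
  · rintro y ⟨x, hx, hxy⟩
    rcases hp.terminal (p x) (hp.fiber (p x)) rfl K ⟨x, rfl, hx⟩ with h1 | h1
    · exact h1 hxy.symm
    · exact absurd ⟨p x, h1⟩ h

/-- Since `p` is open, a fiber with interior would make a point of the connected circle clopen. -/
lemma interior_fiber (hp : IsCircleOfPseudoArcs p) (z : Circle) :
    interior (p ⁻¹' {z}) = ∅ := by
  by_contra hne
  obtain ⟨x, hx⟩ := nonempty_iff_ne_empty.2 hne
  have hopen := hp.isOpenMap _ (isOpen_interior (s := p ⁻¹' {z}))
  have heq : p '' interior (p ⁻¹' {z}) = {z} := by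
    apply Subset.antisymm
    · rintro _ ⟨y, hy, rfl⟩
      exact (interior_subset hy : y ∈ p ⁻¹' {z})
    · rintro _ rfl
      exact ⟨x, hx, (interior_subset hx : x ∈ p ⁻¹' {_})⟩
  rw [heq] at hopen
  have huniv := IsClopen.eq_univ ⟨isClosed_singleton, hopen⟩ (singleton_nonempty z)
  have hneg : (-1 : Circle) = 1 := by
    have hsub : (univ : Set Circle).Subsingleton := huniv ▸ subsingleton_singleton
    exact hsub (mem_univ _) (mem_univ _)
  have := congrArg (fun u : Circle => (u : ℂ).re) hneg
  norm_num at this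

/-- Proper subcontinua of fibers are filament. -/
lemma filament_of_ssubset_fiber [CompactSpace X] (hp : IsCircleOfPseudoArcs p) {z : Circle}
    {K : Hyperspace X} (hK : K.carrier ⊂ p ⁻¹' {z}) : K.Filament := by
  obtain ⟨hsub, y, hyz, hyK⟩ := (ssubset_iff_exists).1 hK
  -- Since `closure U` misses `y`, the closed component cannot contain the fiber, so terminality
  -- puts it inside the fiber.
  obtain ⟨U, hU, hKU, hUy⟩ := normal_exists_closure_subset K.isCompact_carrier.isClosed
    (isOpen_compl_singleton (x := y)) (fun w hw h => hyK (h ▸ hw))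
  refine ⟨U, hU, hKU, fun x hx => ?_⟩
  rw [← subset_empty_iff, ← hp.interior_fiber z]
  apply interior_mono
  have hcl : closure (connectedComponentIn U x) ⊆ closure U :=
    closure_mono (connectedComponentIn_subset U x)
  have hxC : x ∈ connectedComponentIn U x := mem_connectedComponentIn (hKU hx)
  have hconn : IsConnected (closure (connectedComponentIn U x)) :=
    IsConnected.closure ⟨⟨x, hxC⟩, isPreconnected_connectedComponentIn⟩
  rcases hp.terminal z (hp.fiber z) rfl (ofSet _ isClosed_closure.isCompact hconn)
    ⟨x, hsub hx, subset_closure hxC⟩ with h | h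
  · exact absurd rfl (hUy (hcl (h hyz)))
  · exact subset_closure.trans h

lemma ample_fiber [CompactSpace X] (hp : IsCircleOfPseudoArcs p) (z : Circle) :
    (hp.fiber z).Ample := by
  have : LocallyConnectedSpace Circle :=
    ChartedSpace.locallyConnectedSpace (EuclideanSpace ℝ (Fin 1)) Circle
  intro U hU hzU
  have hclm : IsClosedMap p := hp.continuous.isClosedMap
  have hV : (p '' Uᶜ)ᶜ ∈ 𝓝 z := by
    refine (hclm _ hU.isClosed_compl).isOpen_compl.mem_nhds ?_
    rintro ⟨x, hx, hxz⟩
    exact hx (hzU hxz)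
  obtain ⟨T, hT, hTc, hTV⟩ := exists_mem_nhds_isClosed_subset hV
  obtain ⟨W, hWT, hWo, hzW, hWc⟩ :=
    locallyConnectedSpace_iff_subsets_isOpen_isConnected.1 this z T hT
  -- A closed quotient map with connected fibers pulls closed connected sets back to connected sets.
  have hconn : IsConnected (p ⁻¹' closure W) :=
    (hclm.isQuotientMap hp.continuous hp.surjective).isCoinducing.isConnected_preimage_of_isClosed
      (fun z => (hp.fiber z).isConnected_carrier) isClosed_closure hWc.closure
  refine ⟨ofSet _ (isClosed_closure.preimage hp.continuous).isCompact hconn, ?_, ?_⟩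
  · refine Subset.trans ?_ (interior_mono (preimage_mono subset_closure : p ⁻¹' W ⊆ p ⁻¹' closure W))
    rw [(hWo.preimage hp.continuous).interior_eq]
    rintro x rfl
    exact hzW
  · intro x hx
    by_contra hxU
    exact hTV (closure_minimal hWT hTc hx) ⟨x, hxU, rfl⟩

/-- A filament subcontinuum lies in a fiber. -/
lemma exists_subset_fiber_of_filament (hp : IsCircleOfPseudoArcs p) {K : Hyperspace X}
    (hK : K.Filament) : ∃ z, K.carrier ⊆ p ⁻¹' {z} := by
  refine (hp.subset_fiber_or_saturated K).resolve_right ?_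
  rintro ⟨hnt, hsat⟩
  obtain ⟨U, -, hKU, hint⟩ := hK
  obtain ⟨w, hw⟩ := Circle.interior_nonempty_of_isPreconnected
    (K.isConnected_carrier.isPreconnected.image p hp.continuous.continuousOn) hnt
  obtain ⟨x, rfl⟩ := hp.surjective w
  have hxK : x ∈ K.carrier := hsat (interior_subset hw : p x ∈ p '' K.carrier)
  have hxint : x ∈ interior K.carrier :=
    interior_maximal ((preimage_mono interior_subset).trans hsat)
      (isOpen_interior.preimage hp.continuous) hw
  have := interior_mono
    (K.isConnected_carrier.isPreconnected.subset_connectedComponentIn hxK hKU) hxint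
  rw [hint x hxK] at this
  exact this

lemma fiber_mem_closure_filamentPortion [CompactSpace X] (hp : IsCircleOfPseudoArcs p)
    (z : Circle) : hp.fiber z ∈ closure (filamentPortion X) := by
  have := (hp.pseudoArc z).compact
  have := (hp.pseudoArc z).connected
  have := (hp.pseudoArc z).nondegenerate
  rw [Metric.mem_closure_iff]
  intro ε hε
  obtain ⟨K, hK, hdense⟩ :=
    exists_ne_univ_forall_dist_le (hp.pseudoArc z).hereditarilyIndecomposable (half_pos hε)
  have hsub : Subtype.val '' K.carrier ⊆ p ⁻¹' {z} := by
    rintro _ ⟨y, -, rfl⟩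
    exact y.2
  refine ⟨ofSet (Subtype.val '' K.carrier) (K.isCompact_carrier.image continuous_subtype_val)
    (K.isConnected_carrier.image _ continuous_subtype_val.continuousOn), ?_, ?_⟩
  · obtain ⟨y, hy⟩ := (ne_univ_iff_exists_notMem _).1 hK
    refine hp.filament_of_ssubset_fiber (z := z) ((ssubset_iff_exists).2 ⟨hsub, y, y.2, ?_⟩)
    rintro ⟨w, hw, h⟩
    exact hy (Subtype.ext h ▸ hw)
  · rw [Subtype.dist_eq, Metric.NonemptyCompacts.dist_eq]
    refine lt_of_le_of_lt
      (Metric.hausdorffDist_le_of_mem_dist (half_pos hε).le ?_ ?_) (half_lt_self hε)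
    · intro c hc
      obtain ⟨y, hy, hyd⟩ := hdense ⟨c, hc⟩
      exact ⟨y, ⟨y, hy, rfl⟩, hyd⟩
    · intro y hy
      exact ⟨y, hsub hy, by simpa using (half_pos hε).le⟩

end IsCircleOfPseudoArcs

/-! ### Whitney maps and the conclusion -/

namespace IsWhitneyMap

variable {X : Type*} [MetricSpace X] {μ : NonemptyCompacts X → ℝ}

lemma whitneyRestrict_lt (hμ : IsWhitneyMap μ) {K L : Hyperspace X}
    (h : K.carrier ⊂ L.carrier) : whitneyRestrict μ K < whitneyRestrict μ L :=
  hμ.strictMono _ _ h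

lemma whitneyRestrict_le (hμ : IsWhitneyMap μ) {K L : Hyperspace X}
    (h : K.carrier ⊆ L.carrier) : whitneyRestrict μ K ≤ whitneyRestrict μ L := by
  rcases h.eq_or_ssubset with h | h
  · rw [Hyperspace.carrier_injective h]
  · exact (hμ.whitneyRestrict_lt h).le

lemma continuous_whitneyRestrict (hμ : IsWhitneyMap μ) : Continuous (whitneyRestrict μ) :=
  hμ.continuous.comp continuous_subtype_val

end IsWhitneyMap

theorem mainTheorem5 {X : Type*} [MetricSpace X] [CompactSpace X] [ConnectedSpace X]
    (p : X → Circle) (hp : IsCircleOfPseudoArcs p)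
    (μ : TopologicalSpace.NonemptyCompacts X → ℝ) (hμ : IsWhitneyMap μ)
    (l : ℝ) (hl : ∀ z : Circle, whitneyRestrict μ (hp.fiber z) = l) :
    planckBoundary X = whitneyRestrict μ ⁻¹' {l} := by
  ext K
  constructor
  · rintro ⟨hA, hF⟩
    have hle : whitneyRestrict μ K ≤ l := by
      refine closure_minimal (t := {K | whitneyRestrict μ K ≤ l}) (fun L hL => ?_)
        (isClosed_le hμ.continuous_whitneyRestrict continuous_const) hF
      obtain ⟨z, hz⟩ := hp.exists_subset_fiber_of_filament hL
      exact (hμ.whitneyRestrict_le hz).trans (hl z).le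
    obtain ⟨x, hx⟩ := K.isConnected_carrier.nonempty
    refine le_antisymm hle ?_
    rw [← hl (p x)]
    rcases hp.terminal (p x) (hp.fiber (p x)) rfl K ⟨x, rfl, hx⟩ with h | h
    · exact hμ.whitneyRestrict_le h
    · rcases h.eq_or_ssubset with h | h
      · exact hμ.whitneyRestrict_le h.ge
      · exact absurd hA (hp.filament_of_ssubset_fiber h).not_ample
  · intro hK
    have hK : whitneyRestrict μ K = l := hK
    obtain ⟨x, hx⟩ := K.isConnected_carrier.nonempty
    have heq : K = hp.fiber (p x) := by
      apply Hyperspace.carrier_injective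
      rcases hp.terminal (p x) (hp.fiber (p x)) rfl K ⟨x, rfl, hx⟩ with h | h
      · refine (h.eq_or_ssubset.resolve_right fun h' => ?_).symm
        have := hμ.whitneyRestrict_lt h'
        rw [hK, hl] at this
        exact this.false
      · refine h.eq_or_ssubset.resolve_right fun h' => ?_
        have := hμ.whitneyRestrict_lt h'
        rw [hK, hl] at this
        exact this.false
    rw [heq]
    exact ⟨hp.ample_fiber _, hp.fiber_mem_closure_filamentPortion _⟩
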